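/- Let $p$ be a prime and let $K_0/\mathbb{Q}_p$ be an extension of discretely valued fields, i.e. a (not necessarily finite) field extension together with a discrete valuation $\nu_p : K_0 \to \mathbb{Q}\cup\{\infty\}$ extending the $p$-adic valuation of $\mathbb{Q}_p$, normalised by $\nu_p(p)=1$. Let $\mathcal{O}_0=\{x\in K_0 : \nu_p(x)\ge 0\}$. Let $A$ be a finite-dimensional semisimple $K_0$-algebra. An $\mathcal{O}_0$-order in $A$ is an $\mathcal{O}_0$-subalgebra of $A$ which is free and finitely generated as an $\mathcal{O}_0$-module and spans $A$ over $K_0$. An $\mathcal{O}_0$-order $\Lambda$ is symmetric if there is a symmetric bilinear form $T:A\times A\to K_0$ with $T(ab,c)=T(a,bc)$ for all $a,b,c \in A$ and $\Lambda=\Lambda^\sharp:=\{a\in A : T(a,x)\in\mathcal{O}_0 \text{ for all } x\in\Lambda\}$. The defect of a symmetric $\mathcal{O}_0$-order $\Lambda$ in $A$ is defined as follows. Choose a finite extension $E_0/K_0$ such that $E_0\otimes_{K_0}A\cong\bigoplus_{i=1}^n E_0^{d_i\times d_i}$ is split, extend $\nu_p$ to a discrete valuation on $E_0$, and let $\mathcal{E}_0$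 be its valuation ring. Let $\operatorname{Tr}_i$ denote the trace on the $i$-th matrix summand. Then there are $u_1,\dots,u_n\in E_0^\times$ such that $\mathcal{E}_0\otimes_{\mathcal{O}_0}\Lambda$ is self-dual with respect to the form $(a,b)\mapsto\sum_{i=1}^n u_i\operatorname{Tr}_i(ab)$, and the defect of $\Lambda$ is $\max_{1\le i\le n}\{-\nu_p(u_i)\}$. Proposition. Let $\Gamma$ be a maximal $\mathcal{O}_0$-order in $A$ and let $\Lambda\subseteq\Gamma$ be a symmetric $\mathcal{O}_0$-order in $A$ of defect $d$. Then $\Gamma/\Lambda$ and $\mathcal{O}_0/p\mathcal{O}_0$ have finite length over $\mathcal{O}_0$ and $$\operatorname{length}_{\mathcal{O}_0}(\Gamma/\Lambda)\;\le\;\tfrac12\cdot e\cdot d\cdot\dim_{K_0}(A),\qquad e=\operatorname{length}_{\mathcal{O}_0}(\mathcal{O}_0/p\mathcal{O}_0).$$ -/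

import Mathlib

open scoped TensorProduct

namespace SymmetricOrder

universe u w

section Valuations

variable {K : Type u} [Field K]

/-- The (exponential, additively written) valuation `v : K → ℚ ∪ {∞}` is discrete: its value
group is generated by one positive element, the value of a uniformizer `ϖ`. -/
def IsDiscrete (v : AddValuation K (WithTop ℚ)) : Prop :=
  ∃ ϖ : K, ϖ ≠ 0 ∧ 0 < v ϖ ∧ ∀ x : K, x ≠ 0 → ∃ n : ℤ, v x = v (ϖ ^ n)

/-- `K / ℚ_p`, with the valuation `v` on `K`, is an extension of discretely valued fields: `v` is
discrete and restricts to the usual valuation `ν_p` of `ℚ_p`, normalised by `ν_p(p) = 1`. -/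
structure IsDiscretelyValuedExtension (p : ℕ) [Fact p.Prime] [Algebra ℚ_[p] K]
    (v : AddValuation K (WithTop ℚ)) : Prop where
  discrete : IsDiscrete v
  extends_padic : ∀ x : ℚ_[p], x ≠ 0 →
    v (algebraMap ℚ_[p] K x) = (((x.valuation : ℤ) : ℚ) : WithTop ℚ)

/-- The valuation ring `{x | v x ≥ 0}`. -/
def ringOfIntegers (v : AddValuation K (WithTop ℚ)) : Subring K where
  carrier := {x | 0 ≤ v x}
  mul_mem' {a b} ha hb := by
    change 0 ≤ v (a * b)
    rw [v.map_mul]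
    exact add_nonneg ha hb
  one_mem' := by simp
  add_mem' {a b} ha hb := v.map_le_add ha hb
  zero_mem' := by simp
  neg_mem' {a} ha := by simpa [v.map_neg] using ha

end Valuations

section Orders

variable {K : Type u} [Field K] {A : Type w} [Ring A] [Algebra K A] {O : Subring K}

/-- `Λ` is an `O`-order in the `K`-algebra `A`: an `O`-subalgebra which is free and finitely
generated as an `O`-module and spans `A` over `K`. -/
structure IsOrder (Λ : Subalgebra O A) : Prop where
  free : Module.Free O Λ
  finite : Module.Finite O Λ
  span_eq_top : Submodule.span K (Λ : Set A) = ⊤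

/-- `Γ` is a maximal `O`-order in `A`. -/
def IsMaximalOrder (Γ : Subalgebra O A) : Prop :=
  Maximal (fun Δ : Subalgebra O A => IsOrder Δ) Γ

/-- `Λ` is self-dual with respect to `T`: it equals
`Λ^♯ = {a ∈ A | T(a, x) ∈ O for all x ∈ Λ}`. -/
def IsSelfDual (T : LinearMap.BilinForm K A) (Λ : Subalgebra O A) : Prop :=
  ∀ a : A, a ∈ Λ ↔ ∀ x ∈ Λ, T a x ∈ O

/-- `Λ` is a symmetric `O`-order in `A`: an order which is self-dual with respect to a
symmetric, associative bilinear form `T : A × A → K` (a symmetrising form for `Λ`). -/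
def IsSymmetricOrder (Λ : Subalgebra O A) : Prop :=
  IsOrder Λ ∧ ∃ T : LinearMap.BilinForm K A,
    (∀ a b : A, T a b = T b a) ∧ (∀ a b c : A, T (a * b) c = T a (b * c)) ∧ IsSelfDual T Λ

end Orders

section Defect

/-- For a split semisimple algebra `φ : B ≃ ⨁ᵢ F^{mᵢ × mᵢ}` and weights `uᵢ ∈ F`, the form
`T(a, b) = ∑ᵢ uᵢ · Trᵢ(a b)`, where `Trᵢ` is the trace on the `i`-th matrix summand. -/
noncomputable def weightedTraceForm {F : Type*} [Field F] {B : Type*} [Ring B] [Algebra F B]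
    {n : ℕ} {m : Fin n → ℕ} (φ : B ≃ₐ[F] ((i : Fin n) → Matrix (Fin (m i)) (Fin (m i)) F))
    (u : Fin n → F) : LinearMap.BilinForm F B :=
  LinearMap.mk₂ F (fun a b => ∑ i, u i * (φ (a * b) i).trace)
    (fun a a' b => by simp [add_mul, mul_add, Finset.sum_add_distrib])
    (fun c a b => by simp [Finset.mul_sum, mul_left_comm])
    (fun a b b' => by simp [mul_add, Finset.sum_add_distrib])
    (fun c a b => by simp [Finset.mul_sum, mul_left_comm])

/-- `d` is the defect of the order `Λ` in a split semisimple `F`-algebra `B`, `F` with discrete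
valuation `w`: `B ≅ ⨁ᵢ F^{mᵢ × mᵢ}`, and `Λ` is self-dual with respect to
`T(a, b) = ∑ᵢ uᵢ · Trᵢ(a b)` for some `uᵢ ∈ F^×` with `d = maxᵢ (- w(uᵢ))`. -/
def IsSplitDefect {F : Type*} [Field F] {B : Type*} [Ring B] [Algebra F B]
    (w : AddValuation F (WithTop ℚ)) (Λ : Subalgebra (ringOfIntegers w) B) (d : ℚ) : Prop :=
  ∃ (n : ℕ) (m : Fin n → ℕ) (φ : B ≃ₐ[F] ((i : Fin n) → Matrix (Fin (m i)) (Fin (m i)) F))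
    (u : Fin n → F),
    (∀ i, 0 < m i) ∧ (∀ i, u i ≠ 0) ∧ IsSelfDual (weightedTraceForm φ u) Λ ∧
      IsGreatest {x : ℚ | ∃ i, w (u i) = ((-x : ℚ) : WithTop ℚ)} d

/-- The `R`-subalgebra of an `F`-algebra `B` generated by `S`, for a subring `R` of `F`. -/
def generatedSubalgebra {F : Type*} [Field F] {B : Type*} [Ring B] [Algebra F B] (R : Subring F)
    (S : Set B) : Subalgebra R B :=
  Algebra.adjoin R S

/-- `d` is the defect of the symmetric order `Λ` in the semisimple `K`-algebra `A`: it is the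
defect of `𝓔 ⊗_O Λ` in the split algebra `E ⊗_K A`, for a finite extension `E` of `K` which
splits `A`, with a discrete valuation `w` extending `v` and valuation ring `𝓔`. The order
`𝓔 ⊗_O Λ` is the `𝓔`-subalgebra of `E ⊗_K A` generated by all `1 ⊗ x` with `x ∈ Λ`. -/
def IsDefect {K : Type u} [Field K] (v : AddValuation K (WithTop ℚ)) {A : Type w} [Ring A]
    [Algebra K A] (Λ : Subalgebra (ringOfIntegers v) A) (d : ℚ) : Prop :=
  ∃ (E : Type u) (_ : Field E) (_ : Algebra K E) (w : AddValuation E (WithTop ℚ)),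
    FiniteDimensional K E ∧ IsDiscrete w ∧ (∀ x : K, w (algebraMap K E x) = v x) ∧
      IsSplitDefect w (generatedSubalgebra (ringOfIntegers w)
        ((fun x : A => (1 : E) ⊗ₜ[K] x) '' (Λ : Set A))) d

end Defect

end SymmetricOrder

/-! The bound compares discriminants. Smith normal form gives bases `g` of `Γ` and `b` of `Λ` with
`b s = a s • g s`, so `Γ/Λ` is the direct sum of the `O/(a s)`, and its length is `e` times the
value of `∏ a s`, because `p` has value 1. Over the splitting field `E` both bases remain bases of
the extended orders. Conjugating each matrix block makes the extended `Γ` act by integral matrices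
and preserves traces, hence preserves the form and its weights. The matrix from matrix units to `b`
is then `R * diagonal a` with `R` integral, while the Gram matrix of the matrix units has
determinant `± ∏ u i ^ (m i)²`. Self-duality makes the inverse Gram matrix of `b` integral, so `2
w(∏ a s) + 2 w(det R) + ∑ (m i)² w(u i) ≤ 0`. Now `w(det R) ≥ 0` and `-w(u i) ≤ d` give `2 w(∏ a s)
≤ d dim A`. The lemmas that carry this are `exists_conj_integral`, `two_mul_le_of_integral` and
`exists_adapted_bases`. -/

namespace SymmetricOrder
-- Discrete valuation rings: values, units and lengths
section Val
variable {K : Type*} [Field K] (v : AddValuation K (WithTop ℚ))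

theorem mem_ringOfIntegers {x : K} : x ∈ ringOfIntegers v ↔ 0 ≤ v x := Iff.rfl

theorem map_finsetProd {ι : Type*} (s : Finset ι) (f : ι → K) :
    v (∏ i ∈ s, f i) = ∑ i ∈ s, v (f i) := by
  classical
  induction s using Finset.induction_on with
  | empty => simp
  | insert i s hi ih => rw [Finset.prod_insert hi, Finset.sum_insert hi, v.map_mul, ih]

theorem exists_coe_eq {x : K} (hx : x ≠ 0) : ∃ q : ℚ, v x = q := by
  obtain ⟨q, hq⟩ := WithTop.ne_top_iff_exists.mp ((v.ne_top_iff).mpr hx)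
  exact ⟨q, hq.symm⟩

theorem isUnit_ringOfIntegers {x : ringOfIntegers v} (hx : v (x : K) = 0) : IsUnit x := by
  have h0 : (x : K) ≠ 0 := fun h => by simp [h] at hx
  refine .of_mul_eq_one ⟨(x : K)⁻¹, ?_⟩ (Subtype.ext (mul_inv_cancel₀ h0))
  rw [mem_ringOfIntegers, v.map_inv, hx]
  rfl

theorem map_eq_zero_of_isUnit {x : ringOfIntegers v} (hx : IsUnit x) : v (x : K) = 0 := by
  obtain ⟨y, hy⟩ := hx.exists_right_inv
  have h : v (x : K) + v (y : K) = 0 := by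
    rw [← v.map_mul, ← Subring.coe_mul, hy, Subring.coe_one, v.map_one]
  exact ((add_eq_zero_iff_of_nonneg x.2 y.2).mp h).1

instance isFractionRing_ringOfIntegers : IsFractionRing (ringOfIntegers v) K := by
  refine .of_field _ _ fun x => ?_
  rcases le_total 0 (v x) with h | h
  · exact ⟨⟨x, h⟩, 1, by simp; rfl⟩
  · by_cases hx : x = 0
    · exact ⟨0, 1, by simp [hx]⟩
    obtain ⟨q, hq⟩ := exists_coe_eq v hx
    refine ⟨1, ⟨x⁻¹, ?_⟩, ?_⟩
    · rw [mem_ringOfIntegers, v.map_inv, hq]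
      rw [hq] at h
      have : q ≤ 0 := by exact_mod_cast h
      have : (0 : ℚ) ≤ -q := by linarith
      exact_mod_cast this
    · change x = 1 / x⁻¹
      simp

variable {v}

/-- A uniformizer, its value, and the resulting factorization of integers. -/
theorem IsDiscrete.exists_irreducible (hv : IsDiscrete v) :
    ∃ (ϖ : ringOfIntegers v) (c : ℚ), Irreducible ϖ ∧ 0 < c ∧ v (ϖ : K) = c ∧
      ∀ x : ringOfIntegers v, x ≠ 0 → ∃ n : ℕ, Associated (ϖ ^ n) x := by
  obtain ⟨ϖ, h0, hpos, hgen⟩ := hv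
  obtain ⟨c, hc⟩ := exists_coe_eq v h0
  have hc0 : 0 < c := by rw [hc] at hpos; exact_mod_cast hpos
  have hz : ∀ n : ℕ, v (ϖ ^ n) = ((n * c : ℚ) : WithTop ℚ) := fun n => by
    rw [v.map_pow, hc, ← WithTop.coe_nsmul, nsmul_eq_mul]
  have hnat : ∀ x : ringOfIntegers v, x ≠ 0 → ∃ n : ℕ, v (x : K) = v (ϖ ^ n) := by
    intro x hx
    obtain ⟨n, hn⟩ := hgen x (by simpa using hx)
    obtain ⟨n, rfl | rfl⟩ := n.eq_nat_or_neg
    · exact ⟨n, by simpa using hn⟩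
    · have hx0 := x.2
      rw [mem_ringOfIntegers, hn, zpow_neg, zpow_natCast, v.map_inv, hz] at hx0
      have : (0 : ℚ) ≤ -(n * c) := by exact_mod_cast hx0
      -- An integral element has nonnegative value, so it cannot be a strictly negative power of the
      -- uniformizer up to units.
      have hn0 : n = 0 := by
        by_contra h
        have : (0 : ℚ) < n * c := mul_pos (by exact_mod_cast Nat.pos_of_ne_zero h) hc0
        linarith
      subst hn0
      exact ⟨0, by simpa using hn⟩
  let π : ringOfIntegers v := ⟨ϖ, hpos.le⟩
  refine ⟨π, c, ⟨fun h => ?_, fun a b hab => ?_⟩, hc0, hc, fun x hx => ?_⟩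
  · exact hpos.ne' (map_eq_zero_of_isUnit v h)
  · have hab' : ϖ = (a : K) * b := congrArg Subtype.val hab
    have ha : a ≠ 0 := by rintro rfl; simp [h0] at hab'
    have hb : b ≠ 0 := by rintro rfl; simp [h0] at hab'
    obtain ⟨m, hm⟩ := hnat a ha
    obtain ⟨n, hn⟩ := hnat b hb
    have h : v ϖ = v (a : K) + v (b : K) := by rw [← v.map_mul, ← hab']
    rw [hm, hn, hz, hz, hc] at h
    have h' : c = m * c + n * c := by exact_mod_cast h
    have h1 : (m + n : ℚ) = 1 := by
      have : (m + n : ℚ) * c = 1 * c := by linarith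
      exact mul_right_cancel₀ hc0.ne' this
    have h2 : m + n = 1 := by exact_mod_cast h1
    rcases (by omega : m = 0 ∨ n = 0) with rfl | rfl
    · exact .inl (isUnit_ringOfIntegers v (by simpa using hm))
    · exact .inr (isUnit_ringOfIntegers v (by simpa using hn))
  · obtain ⟨n, hn⟩ := hnat x hx
    refine ⟨n, ?_⟩
    have hp : ϖ ^ n ≠ 0 := pow_ne_zero _ h0
    have hy : v ((x : K) / ϖ ^ n) = 0 := by
      obtain ⟨q, hq⟩ := exists_coe_eq v hp
      rw [v.map_div, hn, hq]
      exact_mod_cast sub_self q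
    let y : ringOfIntegers v := ⟨x / ϖ ^ n, hy.ge⟩
    obtain ⟨u, hu⟩ := isUnit_ringOfIntegers v (x := y) hy
    refine ⟨u, Subtype.ext ?_⟩
    rw [hu]
    exact mul_div_cancel₀ (x : K) hp

theorem IsDiscrete.isDiscreteValuationRing (hv : IsDiscrete v) :
    IsDiscreteValuationRing (ringOfIntegers v) := by
  obtain ⟨ϖ, _, h, _, _, hϖ⟩ := hv.exists_irreducible
  exact .ofHasUnitMulPowIrreducibleFactorization ⟨ϖ, h, fun {x} hx => hϖ x hx⟩

/-- The length of `O / a O` is proportional to the value of `a`. -/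
theorem IsDiscrete.exists_length_quotient (hv : IsDiscrete v) :
    ∃ c : ℚ, 0 < c ∧ ∀ a : ringOfIntegers v, a ≠ 0 → ∃ n : ℕ,
      Module.length (ringOfIntegers v) (ringOfIntegers v ⧸ Ideal.span {a}) = n ∧
        v (a : K) = ((n * c : ℚ) : WithTop ℚ) := by
  have := hv.isDiscreteValuationRing
  obtain ⟨ϖ, c, h, hc, hϖc, hϖ⟩ := hv.exists_irreducible
  refine ⟨c, hc, fun a ha => ?_⟩
  obtain ⟨n, u, rfl⟩ := hϖ a ha
  refine ⟨n, ?_, ?_⟩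
  · change Ring.ord _ _ = _
    rw [Ring.ord_mul_of_isUnit_right u.isUnit,
      Ring.ord_pow (mem_nonZeroDivisors_of_ne_zero h.ne_zero), Ring.ord_of_irreducible h]
    simp
  · rw [Subring.coe_mul, v.map_mul, map_eq_zero_of_isUnit v u.isUnit, Subring.coe_pow, v.map_pow,
      hϖc, add_zero, ← WithTop.coe_nsmul, nsmul_eq_mul]

theorem le_map_det {n : Type*} [Fintype n] [DecidableEq n] (M : Matrix n n K)
    (hM : ∀ i j, 0 ≤ v (M i j)) : 0 ≤ v M.det := by
  rw [← mem_ringOfIntegers, Matrix.det_apply']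
  refine Subring.sum_mem _ fun σ _ => Subring.mul_mem _ (intCast_mem _ _)
    (Subring.prod_mem _ fun i _ => hM _ _)

theorem map_sign {n : Type*} [Fintype n] [DecidableEq n] (σ : Equiv.Perm n) :
    v ((Equiv.Perm.sign σ : ℤ) : K) = 0 := by
  rcases Int.units_eq_one_or (Equiv.Perm.sign σ) with h | h <;> simp [h, v.map_neg]

end Val

/-! ### Lattices and integral representations -/

section Lattices
open Module

/-- A finitely generated spanning module over a principal ideal domain in a vector space over the
fraction field is the span of a basis. -/
theorem exists_basis_span_range_eq {R F V : Type*} [CommRing R] [IsDomain R]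
    [IsPrincipalIdealRing R] [Field F] [Algebra R F] [IsFractionRing R F] [AddCommGroup V]
    [Module F V] [Module R V] [IsScalarTower R F V] {κ : Type*} (b₀ : Basis κ F V)
    (L : Submodule R V) (hfg : L.FG) (hL : Submodule.span F (L : Set V) = ⊤) :
    ∃ b : Basis κ F V, Submodule.span R (Set.range b) = L := by
  have : Module.Finite R L := Module.Finite.iff_fg.mpr hfg
  have : IsTorsionFree R V := .trans_faithfulSMul R F V
  let β := Free.chooseBasis R L
  have hspan : Submodule.span R (Set.range fun i => (β i : V)) = L := by
    rw [show (fun i => (β i : V)) = L.subtype ∘ β from rfl, Set.range_comp, Submodule.span_image,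
      β.span_eq, Submodule.map_top, Submodule.range_subtype]
  have hli : LinearIndependent F fun i => (β i : V) :=
    (LinearIndependent.iff_fractionRing R F).mp
      (β.linearIndependent.map' L.subtype L.ker_subtype)
  have htop : ⊤ ≤ Submodule.span F (Set.range fun i => (β i : V)) := by
    rw [← hL, Submodule.span_le]
    intro x hx
    rw [← hspan] at hx
    exact Submodule.span_le_restrictScalars R F _ hx
  let b := Basis.mk hli htop
  refine ⟨b.reindex (b.indexEquiv b₀), ?_⟩
  rw [Basis.range_reindex, Basis.coe_mk, hspan]

/-- A finitely generated order acting on `Fⁿ` acts by integral matrices in a suitable basis. -/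
theorem exists_conj_integral {F : Type*} [Field F] (R : Subring F) [IsPrincipalIdealRing R]
    [IsFractionRing R F] {B : Type*} [Ring B] [Algebra F B] (Δ : Subalgebra R B)
    (hΔ : (Subalgebra.toSubmodule Δ).FG) {n : Type*} [Fintype n] [DecidableEq n]
    (ρ : B →ₐ[F] Matrix n n F) :
    ∃ χ : Matrix n n F ≃ₐ[F] Matrix n n F, (∀ M, (χ M).trace = M.trace) ∧
      ∀ x ∈ Δ, ∀ i j, χ (ρ x) i j ∈ R := by
  -- The lattice `L = ∑ Δ eₖ` generated by the standard vectors is finitely generated, of full rank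
  -- and `Δ`-stable. In an `R`-basis of `L`, elements of `Δ` have integral matrices; `χ` is this
  -- change of basis.
  let ev (k : n) : B →ₗ[R] (n → F) :=
    { toFun := fun x => (ρ x).mulVec (Pi.single k 1)
      map_add' := fun x y => by rw [map_add, Matrix.add_mulVec]
      map_smul' := fun r x => by
        change (ρ ((r : F) • x)).mulVec _ = (r : F) • _
        rw [map_smul, Matrix.smul_mulVec] }
  let L : Submodule R (n → F) := ⨆ k, (Subalgebra.toSubmodule Δ).map (ev k)
  have hLfg : L.FG := Submodule.fg_iSup _ fun k => hΔ.map _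
  have hev : ∀ k, ∀ x ∈ Δ, ev k x ∈ L := fun k x hx =>
    Submodule.mem_iSup_of_mem k (Submodule.mem_map_of_mem hx)
  have hL : Submodule.span F (L : Set (n → F)) = ⊤ := by
    rw [eq_top_iff, ← (Pi.basisFun F n).span_eq, Submodule.span_le]
    rintro _ ⟨k, rfl⟩
    have := hev k 1 Δ.one_mem
    simp only [ev, LinearMap.coe_mk, AddHom.coe_mk, map_one, Matrix.one_mulVec] at this
    rw [Pi.basisFun_apply]
    exact Submodule.subset_span this
  have hstab : ∀ x ∈ Δ, ∀ y ∈ L, (ρ x).mulVec y ∈ L := by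
    intro x hx y hy
    induction hy using Submodule.iSup_induction' with
    | mem k y hy =>
      obtain ⟨z, hz, rfl⟩ := hy
      have := hev k (x * z) (Δ.mul_mem hx hz)
      simpa only [ev, LinearMap.coe_mk, AddHom.coe_mk, map_mul, Matrix.mulVec_mulVec] using this
    | zero => rw [Matrix.mulVec_zero]; exact L.zero_mem
    | add y z _ _ hy hz => rw [Matrix.mulVec_add]; exact L.add_mem hy hz
  obtain ⟨b, hb⟩ := exists_basis_span_range_eq (R := R) (Pi.basisFun F n) L hLfg hL
  refine ⟨Matrix.toLinAlgEquiv'.trans (LinearMap.toMatrixAlgEquiv b), fun M => ?_,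
    fun x hx i j => ?_⟩
  · rw [← Matrix.trace_toLin'_eq M, LinearMap.trace_eq_matrix_trace F b]
    rfl
  · rw [AlgEquiv.trans_apply, LinearMap.toMatrixAlgEquiv_apply, Matrix.toLinAlgEquiv'_apply]
    have hj : b j ∈ L := hb ▸ Submodule.subset_span ⟨j, rfl⟩
    have := hstab x hx _ hj
    rw [← hb, Basis.mem_span_iff_repr_mem] at this
    obtain ⟨r, hr⟩ := this i
    rw [← hr]
    exact r.2

end Lattices

/-! ### The trace form on matrix units -/

section Gram
open Module

variable {F : Type*} [Field F] {B : Type*} [Ring B] [Algebra F B] {n : ℕ} {m : Fin n → ℕ}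
  (φ : B ≃ₐ[F] ((i : Fin n) → Matrix (Fin (m i)) (Fin (m i)) F)) (u : Fin n → F)

/-- The basis of matrix units of a split semisimple algebra. -/
noncomputable def matrixUnitBasis : Basis (Σ i : Fin n, Fin (m i) × Fin (m i)) F B :=
  (Pi.basis fun i => Matrix.stdBasis F (Fin (m i)) (Fin (m i))).map φ.symm.toLinearEquiv

theorem matrixUnitBasis_repr (x : B) (s : Σ i : Fin n, Fin (m i) × Fin (m i)) :
    (matrixUnitBasis φ).repr x s = φ x s.1 s.2.1 s.2.2 := by
  simp [matrixUnitBasis, Matrix.stdBasis]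

theorem apply_matrixUnitBasis (s : Σ i : Fin n, Fin (m i) × Fin (m i)) :
    φ (matrixUnitBasis φ s) = Pi.single s.1 (Matrix.single s.2.1 s.2.2 1) := by
  obtain ⟨i, j, k⟩ := s
  simp [matrixUnitBasis, Matrix.stdBasis_eq_single]

/-- Transposition of the indices of matrix units. -/
def transposeIndex (m : Fin n → ℕ) : Equiv.Perm (Σ i : Fin n, Fin (m i) × Fin (m i)) :=
  Equiv.sigmaCongrRight fun _ => Equiv.prodComm _ _

/-- Since `Tr(e_{jk} x) = x_{kj}`, pairing with a matrix unit reads off the transposed coordinate.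
-/
theorem weightedTraceForm_matrixUnitBasis (s : Σ i : Fin n, Fin (m i) × Fin (m i)) (x : B) :
    weightedTraceForm φ u (matrixUnitBasis φ s) x =
      u s.1 * (matrixUnitBasis φ).repr x (transposeIndex m s) := by
  rw [matrixUnitBasis_repr]
  change ∑ i, u i * (φ (matrixUnitBasis φ s * x) i).trace = _
  rw [Finset.sum_eq_single s.1]
  · rw [map_mul, Pi.mul_apply, apply_matrixUnitBasis, Pi.single_eq_same,
      Matrix.trace_single_mul]
    exact congrArg (u s.1 * ·) (one_mul _)
  · intro i _ hi
    rw [map_mul, Pi.mul_apply, apply_matrixUnitBasis, Pi.single_eq_of_ne hi]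
    simp
  · simp

theorem det_toMatrix_weightedTraceForm :
    (LinearMap.BilinForm.toMatrix (matrixUnitBasis φ) (weightedTraceForm φ u)).det =
      (∏ s : Σ i : Fin n, Fin (m i) × Fin (m i), u s.1) *
        ((Equiv.Perm.sign (transposeIndex m) : ℤ) : F) := by
  have : LinearMap.BilinForm.toMatrix (matrixUnitBasis φ) (weightedTraceForm φ u) =
      Matrix.diagonal (fun s => u s.1) * (transposeIndex m).permMatrix F := by
    ext s t
    rw [LinearMap.BilinForm.toMatrix_apply, weightedTraceForm_matrixUnitBasis,
      Matrix.diagonal_mul, Basis.repr_self, Finsupp.single_apply, Equiv.Perm.permMatrix,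
      PEquiv.toMatrix_apply]
    simp [eq_comm]
  rw [this, Matrix.det_mul, Matrix.det_diagonal, Matrix.det_permutation]

/-- This allows the splitting to be changed blockwise without altering the weights `u i`, hence
without altering the defect. -/
theorem weightedTraceForm_trans
    (χ : ∀ i, Matrix (Fin (m i)) (Fin (m i)) F ≃ₐ[F] Matrix (Fin (m i)) (Fin (m i)) F)
    (hχ : ∀ i M, (χ i M).trace = M.trace) :
    weightedTraceForm (φ.trans (AlgEquiv.piCongrRight χ)) u = weightedTraceForm φ u := by
  ext a b
  change ∑ i, u i * (χ i (φ (a * b) i)).trace = ∑ i, u i * (φ (a * b) i).trace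
  simp_rw [hχ]

end Gram

/-! ### Discriminant comparison over the splitting field -/

section Discriminant
open Module

variable {F : Type*} [Field F] {w : AddValuation F (WithTop ℚ)} {B : Type*} [Ring B] [Algebra F B]

theorem mem_span_range_iff {κ : Type*} (b : Basis κ F B) (x : B) :
    x ∈ Submodule.span (ringOfIntegers w) (Set.range b) ↔ ∀ i, 0 ≤ w (b.repr x i) := by
  rw [Basis.mem_span_iff_repr_mem]
  refine forall_congr' fun i => ⟨?_, fun h => ⟨⟨_, h⟩, rfl⟩⟩
  rintro ⟨r, hr⟩
  rw [← hr]
  exact r.2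

/-- The inverse Gram matrix of a self-dual order is integral. -/
theorem le_map_inv_toMatrix_of_isSelfDual {κ : Type*} [Fintype κ] [DecidableEq κ]
    (T : LinearMap.BilinForm F B) (Λ : Subalgebra (ringOfIntegers w) B) (b : Basis κ F B)
    (hb : Subalgebra.toSubmodule Λ = Submodule.span (ringOfIntegers w) (Set.range b))
    (hT : IsSelfDual T Λ) (hdet : IsUnit (LinearMap.BilinForm.toMatrix b T).det) (i j : κ) :
    0 ≤ w ((LinearMap.BilinForm.toMatrix b T)⁻¹ i j) := by
  set G := LinearMap.BilinForm.toMatrix b T with hG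
  have hmem : ∀ x, x ∈ Λ ↔ ∀ i, 0 ≤ w (b.repr x i) := fun x => by
    rw [← Subalgebra.mem_toSubmodule, hb, mem_span_range_iff]
  let x : B := ∑ k, G⁻¹ i k • b k
  have hx : ∀ k, b.repr x k = G⁻¹ i k := fun k => by rw [b.repr_sum_self]
  rw [← hx]
  refine (hmem x).mp ((hT x).mpr fun y hy => ?_) j
  have hxb : ∀ k, T x (b k) = (1 : Matrix κ κ F) i k := fun k => by
    rw [← Matrix.nonsing_inv_mul G hdet, Matrix.mul_apply, map_sum, LinearMap.sum_apply]
    refine Finset.sum_congr rfl fun l _ => ?_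
    rw [map_smul, LinearMap.smul_apply, smul_eq_mul, hG, LinearMap.BilinForm.toMatrix_apply]
  rw [← b.sum_repr y, map_sum]
  refine Subring.sum_mem _ fun k _ => ?_
  rw [map_smul, smul_eq_mul, hxb]
  refine Subring.mul_mem _ ((hmem y).mp hy k) ?_
  rw [Matrix.one_apply]
  split_ifs
  exacts [Subring.one_mem _, Subring.zero_mem _]

variable {n : ℕ} {m : Fin n → ℕ}
  (φ : B ≃ₐ[F] ((i : Fin n) → Matrix (Fin (m i)) (Fin (m i)) F)) (u : Fin n → F)

/-- Comparison of discriminants with the order of integral matrices. -/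
theorem two_mul_le_of_integral (g b : Basis (Σ i : Fin n, Fin (m i) × Fin (m i)) F B)
    (hg : ∀ s i j k, 0 ≤ w (φ (g s) i j k)) (Λ : Subalgebra (ringOfIntegers w) B)
    (hb : Subalgebra.toSubmodule Λ = Submodule.span (ringOfIntegers w) (Set.range b))
    (a : (Σ i : Fin n, Fin (m i) × Fin (m i)) → F) (hab : ∀ s, b s = a s • g s)
    (hu : ∀ i, u i ≠ 0) (hT : IsSelfDual (weightedTraceForm φ u) Λ) {d q : ℚ}
    (hd : ∀ x : ℚ, (∃ i, w (u i) = ((-x : ℚ) : WithTop ℚ)) → x ≤ d)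
    (hq : w (∏ s, a s) = q) :
    2 * q ≤ d * Fintype.card (Σ i : Fin n, Fin (m i) × Fin (m i)) := by
  let c := matrixUnitBasis φ
  let R := c.toMatrix g
  let P := c.toMatrix b
  let T := weightedTraceForm φ u
  let G := LinearMap.BilinForm.toMatrix b T
  let C := LinearMap.BilinForm.toMatrix c T
  have hP : P = R * Matrix.diagonal a := by
    ext s t
    change c.repr (b t) s = (R * Matrix.diagonal a) s t
    rw [Matrix.mul_diagonal, hab, map_smul, Finsupp.smul_apply, smul_eq_mul, mul_comm]
    rfl
  have hR : 0 ≤ w R.det := le_map_det R fun s t => by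
    change 0 ≤ w (c.repr (g t) s)
    rw [matrixUnitBasis_repr]
    exact hg _ _ _ _
  have hPdet : P.det = R.det * ∏ s, a s := by rw [hP, Matrix.det_mul, Matrix.det_diagonal]
  have hP0 : P.det ≠ 0 := by
    have h : P * b.toMatrix c = 1 := Basis.toMatrix_mul_toMatrix_flip _ _
    have h' := congrArg Matrix.det h
    rw [Matrix.det_mul, Matrix.det_one] at h'
    exact left_ne_zero_of_mul_eq_one h'
  have hCdet : C.det = (∏ s : Σ i : Fin n, Fin (m i) × Fin (m i), u s.1) *
      ((Equiv.Perm.sign (transposeIndex m) : ℤ) : F) := det_toMatrix_weightedTraceForm φ u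
  have hC0 : C.det ≠ 0 := by
    rw [hCdet]
    refine mul_ne_zero (Finset.prod_ne_zero_iff.mpr fun s _ => hu _) fun h => ?_
    have := map_sign (v := w) (transposeIndex m)
    simp [h] at this
  have hG : P.transpose * C * P = G := LinearMap.BilinForm.toMatrix_mul_basis_toMatrix c b T
  have hGdet : G.det = P.det * C.det * P.det := by
    rw [← hG, Matrix.det_mul, Matrix.det_mul, Matrix.det_transpose]
  have hGu : IsUnit G.det := by
    rw [hGdet]
    exact (mul_ne_zero (mul_ne_zero hP0 hC0) hP0).isUnit
  have hGinv : 0 ≤ w G⁻¹.det :=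
    le_map_det _ (le_map_inv_toMatrix_of_isSelfDual T Λ b hb hT hGu)
  have h1 : G⁻¹.det * G.det = 1 := by
    rw [← Matrix.det_mul, Matrix.nonsing_inv_mul G hGu, Matrix.det_one]
  choose y hy using fun i => exists_coe_eq w (hu i)
  have hwC : w C.det = ((∑ s : Σ i : Fin n, Fin (m i) × Fin (m i), y s.1 : ℚ) : WithTop ℚ) := by
    rw [hCdet, w.map_mul, map_sign, add_zero, map_finsetProd, WithTop.coe_sum]
    exact Finset.sum_congr rfl fun s _ => hy _
  have hyd : -(d * Fintype.card (Σ i : Fin n, Fin (m i) × Fin (m i))) ≤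
      ∑ s : Σ i : Fin n, Fin (m i) × Fin (m i), y s.1 := by
    have : ∑ s : Σ i : Fin n, Fin (m i) × Fin (m i), (-d) ≤
        ∑ s : Σ i : Fin n, Fin (m i) × Fin (m i), y s.1 :=
      Finset.sum_le_sum fun s _ => neg_le.mp (hd (-y s.1) ⟨s.1, by rw [neg_neg, hy]⟩)
    rw [Finset.sum_const, Finset.card_univ, nsmul_eq_mul] at this
    linarith
  obtain ⟨r, hr⟩ := exists_coe_eq w (left_ne_zero_of_mul (hPdet ▸ hP0))
  obtain ⟨t, ht⟩ := exists_coe_eq w (left_ne_zero_of_mul_eq_one h1)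
  -- Taking values in `det G⁻¹ * det G = 1`, with `G = Pᵀ C P` and `P = R * diagonal a`, gives `t +
  -- 2 (r + q) + z = 0`, where `t, r ≥ 0` and `z ≥ -d dim B`.
  have key := congrArg w h1
  rw [hGdet, hPdet] at key
  simp only [w.map_mul, w.map_one, hwC, hr, ht, hq] at key
  rw [hr] at hR
  rw [ht] at hGinv
  have hR' : 0 ≤ r := by exact_mod_cast hR
  have ht' : 0 ≤ t := by exact_mod_cast hGinv
  generalize (∑ s : Σ i : Fin n, Fin (m i) × Fin (m i), y s.1) = z at key hyd
  have key' : t + (r + q + z + (r + q)) = 0 := by exact_mod_cast key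
  linarith

/-- The discriminant bound in the split case. -/
theorem IsSplitDefect.two_mul_le {κ : Type*} [Fintype κ] (hw : IsDiscrete w)
    (Γ Λ : Subalgebra (ringOfIntegers w) B) (g b : Basis κ F B)
    (hg : Subalgebra.toSubmodule Γ = Submodule.span (ringOfIntegers w) (Set.range g))
    (hb : Subalgebra.toSubmodule Λ = Submodule.span (ringOfIntegers w) (Set.range b))
    (a : κ → F) (hab : ∀ s, b s = a s • g s) {d q : ℚ} (hd : IsSplitDefect w Λ d)
    (hq : w (∏ s, a s) = q) :
    2 * q ≤ d * Fintype.card κ := by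
  have := hw.isDiscreteValuationRing
  obtain ⟨n, m, φ, u, -, hu, hT, -, hmax⟩ := hd
  have hfg : (Subalgebra.toSubmodule Γ).FG := hg ▸ Submodule.fg_span (Set.finite_range _)
  choose χ hχ hint using fun i => exists_conj_integral (ringOfIntegers w) Γ hfg
    ((Pi.evalAlgHom F (fun i => Matrix (Fin (m i)) (Fin (m i)) F) i).comp (φ : B →ₐ[F] _))
  let e := g.indexEquiv (matrixUnitBasis φ)
  rw [Fintype.card_congr e]
  refine two_mul_le_of_integral (w := w) (φ.trans (AlgEquiv.piCongrRight χ)) u (g.reindex e)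
    (b.reindex e) (fun s i j k => hint i _ ?_ j k) Λ ?_ (a ∘ e.symm) (fun s => ?_) hu ?_
    (fun x hx => hmax hx) ?_
  · rw [← Subalgebra.mem_toSubmodule, hg, Basis.reindex_apply]
    exact Submodule.subset_span ⟨_, rfl⟩
  · rw [Basis.range_reindex, hb]
  · rw [Basis.reindex_apply, Basis.reindex_apply, hab]
    rfl
  · rwa [weightedTraceForm_trans φ u χ hχ]
  · rw [← hq]
    exact congrArg w (Equiv.prod_comp e.symm a)

end Discriminant

/-! ### Smith normal form for nested lattices -/

section AdaptedBases
open Module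

variable {R F V : Type*} [CommRing R] [Field F] [Algebra R F] [IsFractionRing R F]
  [AddCommGroup V] [Module F V] [Module R V] [IsScalarTower R F V] {κ : Type*} [Fintype κ]

/-- A basis of a lattice of full rank is a basis of the ambient vector space. -/
theorem exists_basis_coe_eq (b₀ : Basis κ F V) {M : Type*} [AddCommGroup M] [Module R M]
    (G : Basis κ R M) (f : M →ₗ[R] V) (hf : Function.Injective f) :
    ∃ g : Basis κ F V, ⇑g = f ∘ G ∧ Submodule.span R (Set.range g) = LinearMap.range f := by
  have := Module.Finite.of_basis b₀
  have hli : LinearIndependent F (f ∘ G) :=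
    (LinearIndependent.iff_fractionRing R F).mp
      (G.linearIndependent.map' f (LinearMap.ker_eq_bot.mpr hf))
  have hspan : Submodule.span R (Set.range (f ∘ G)) = LinearMap.range f := by
    rw [Set.range_comp, Submodule.span_image, G.span_eq, Submodule.map_top]
  have hg := coe_basisOfLinearIndependentOfCardEqFinrank' (f ∘ G) hli
    (finrank_eq_card_basis b₀).symm
  exact ⟨_, hg, by rw [hg, hspan]⟩

variable [IsDomain R] [IsPrincipalIdealRing R]

/-- A lattice has the rank of the ambient vector space. -/
theorem finrank_lattice_eq (b₀ : Basis κ F V) (L : Submodule R V) (hfg : L.FG)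
    (hL : Submodule.span F (L : Set V) = ⊤) : finrank R L = Fintype.card κ := by
  obtain ⟨b, rfl⟩ := exists_basis_span_range_eq b₀ L hfg hL
  exact finrank_span_eq_card ((LinearIndependent.iff_fractionRing R F).mpr b.linearIndependent)

/-- Adapted bases of two nested lattices, and the resulting length of the quotient. -/
theorem exists_adapted_bases (b₀ : Basis κ F V) {M N : Submodule R V} (hNM : N ≤ M)
    (hM : M.FG) (hN : N.FG) (hMs : Submodule.span F (M : Set V) = ⊤) (hNs : Submodule.span F (N : Set V) = ⊤) :
    ∃ (g b : Basis κ F V) (a : κ → R),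
      M = Submodule.span R (Set.range g) ∧ N = Submodule.span R (Set.range b) ∧
      (∀ s, b s = algebraMap R F (a s) • g s) ∧ (∀ s, a s ≠ 0) ∧
      Module.length R (M ⧸ N.submoduleOf M) =
        ∑ s, Module.length R (R ⧸ Ideal.span {a s}) := by
  have : Module.Finite R M := Module.Finite.iff_fg.mpr hM
  have : IsTorsionFree R V := .trans_faithfulSMul R F V
  have hMr := finrank_lattice_eq b₀ M hM hMs
  -- Equal ranks give a Smith normal form with all coefficients nonzero, so both adapted families
  -- have index type `κ`.
  have hNr : finrank R (N.submoduleOf M) = finrank R M := by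
    rw [hMr, ← finrank_lattice_eq b₀ N hN hNs]
    exact (Submodule.submoduleOfEquivOfLe hNM).finrank_eq
  let β : Basis κ R M := (finBasisOfFinrankEq R M hMr).reindex (Fintype.equivFin κ).symm
  obtain ⟨g, hg, hgM⟩ := exists_basis_coe_eq b₀ (Submodule.smithNormalFormTopBasis β hNr)
    M.subtype M.injective_subtype
  obtain ⟨b, hb, hbN⟩ := exists_basis_coe_eq b₀ (Submodule.smithNormalFormBotBasis β hNr)
    (M.subtype ∘ₗ (N.submoduleOf M).subtype)
    (M.injective_subtype.comp (N.submoduleOf M).injective_subtype)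
  refine ⟨g, b, Submodule.smithNormalFormCoeffs β hNr, ?_, ?_, fun s => ?_,
    Submodule.smithNormalFormCoeffs_ne_zero β hNr, ?_⟩
  · rw [hgM, Submodule.range_subtype]
  · rw [hbN, LinearMap.range_comp, Submodule.range_subtype]
    exact (Submodule.map_comap_eq_of_le (by rwa [Submodule.range_subtype])).symm
  · rw [hg, hb, algebraMap_smul]
    exact congrArg Subtype.val (Submodule.smithNormalFormBotBasis_def β hNr s)
  · rw [(Submodule.quotientEquivPiSpan _ β hNr).length_eq, Module.length_pi_of_fintype]

end AdaptedBases

/-! ### Extension of scalars and conclusion -/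

section Orders
open Module

variable {K : Type*} [Field K] {v : AddValuation K (WithTop ℚ)} {A : Type*} [Ring A] [Algebra K A]

/-- The extension of scalars of an order is spanned by the extension of a basis. -/
theorem toSubmodule_generatedSubalgebra {E : Type*} [Field E] [Algebra K E]
    (w : AddValuation E (WithTop ℚ)) (hw : ∀ x : K, w (algebraMap K E x) = v x) {κ : Type*}
    (b : Basis κ K A) (Δ : Subalgebra (ringOfIntegers v) A)
    (hb : Subalgebra.toSubmodule Δ = Submodule.span (ringOfIntegers v) (Set.range b)) :
    Subalgebra.toSubmodule (generatedSubalgebra (ringOfIntegers w)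
      ((fun x : A => (1 : E) ⊗ₜ[K] x) '' (Δ : Set A))) =
        Submodule.span (ringOfIntegers w) (Set.range (Algebra.TensorProduct.basis E b)) := by
  -- The image of `Δ` is already closed under multiplication, so the algebra it generates is just
  -- its linear span.
  let S : Submonoid (E ⊗[K] A) := Δ.toSubmonoid.map
    (Algebra.TensorProduct.includeRight : A →ₐ[K] E ⊗[K] A)
  have hS : (fun x : A => (1 : E) ⊗ₜ[K] x) '' (Δ : Set A) = (S : Set (E ⊗[K] A)) := rfl
  rw [generatedSubalgebra, Algebra.adjoin_eq_span, hS, Submonoid.closure_eq]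
  refine le_antisymm (Submodule.span_le.mpr ?_) (Submodule.span_mono ?_)
  · rintro _ ⟨x, hx, rfl⟩
    change (1 : E) ⊗ₜ[K] x ∈ Submodule.span _ _
    refine (mem_span_range_iff (Algebra.TensorProduct.basis E b) _).mpr fun i => ?_
    have hx' : x ∈ Subalgebra.toSubmodule Δ := hx
    rw [hb, mem_span_range_iff] at hx'
    rw [Algebra.TensorProduct.basis_repr_tmul, one_smul, Finsupp.mapRange_apply, hw]
    exact hx' i
  · rintro _ ⟨i, rfl⟩
    refine ⟨b i, ?_, (Algebra.TensorProduct.basis_apply b i).symm⟩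
    change b i ∈ Subalgebra.toSubmodule Δ
    rw [hb]
    exact Submodule.subset_span ⟨i, rfl⟩

end Orders
end SymmetricOrder

theorem mainTheorem11 (p : ℕ) [Fact p.Prime]
    {K : Type*} [Field K] [Algebra ℚ_[p] K] (v : AddValuation K (WithTop ℚ))
    (hv : SymmetricOrder.IsDiscretelyValuedExtension p v)
    {A : Type*} [Ring A] [Algebra K A] [FiniteDimensional K A] [IsSemisimpleRing A]
    (Γ : Subalgebra (SymmetricOrder.ringOfIntegers v) A) (hΓ : SymmetricOrder.IsMaximalOrder Γ)
    (Λ : Subalgebra (SymmetricOrder.ringOfIntegers v) A) (hΛΓ : Λ ≤ Γ)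
    (hΛ : SymmetricOrder.IsSymmetricOrder Λ)
    (d : ℚ) (hd : SymmetricOrder.IsDefect v Λ d) :
    ∃ l e : ℕ,
      Module.length (SymmetricOrder.ringOfIntegers v)
        (Subalgebra.toSubmodule Γ ⧸
          (Subalgebra.toSubmodule Λ).submoduleOf (Subalgebra.toSubmodule Γ)) = l ∧
      Module.length (SymmetricOrder.ringOfIntegers v)
        (SymmetricOrder.ringOfIntegers v ⧸
          Ideal.span {(p : SymmetricOrder.ringOfIntegers v)}) = e ∧
      (l : ℚ) ≤ 1 / 2 * e * d * Module.finrank K A := by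
  open SymmetricOrder in
  obtain ⟨E, _, _, w, _, hw, hwv, hsplit⟩ := hd
  have := hv.discrete.isDiscreteValuationRing
  obtain ⟨g, b, a, hg, hb, hab, ha, hlen⟩ := exists_adapted_bases (Module.finBasis K A)
    (Subalgebra.toSubmodule.monotone hΛΓ) (Module.Finite.iff_fg.mp hΓ.prop.finite)
    (Module.Finite.iff_fg.mp hΛ.1.finite) hΓ.prop.span_eq_top hΛ.1.span_eq_top
  obtain ⟨c, hc, hlength⟩ := hv.discrete.exists_length_quotient
  have hp0 : (p : ℚ_[p]) ≠ 0 := by exact_mod_cast (Fact.out : p.Prime).ne_zero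
  have hp : v (p : K) = ((1 : ℚ) : WithTop ℚ) := by
    simpa using hv.extends_padic p hp0
  have hpR : (p : ringOfIntegers v) ≠ 0 := fun h => by
    have h' : (p : K) = 0 := congrArg Subtype.val h
    simp [h'] at hp
  obtain ⟨e, he, hve⟩ := hlength p hpR
  choose k hk hvk using fun s => hlength (a s) (ha s)
  refine ⟨∑ s, k s, e, ?_, he, ?_⟩
  · rw [hlen, Nat.cast_sum]
    exact Finset.sum_congr rfl fun s _ => hk s
  -- The normalisation `v p = 1` identifies the value `c` of a uniformizer with `1 / e`, which turns
  -- values into lengths.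
  have hec : (e * c : ℚ) = 1 := by
    have : v (p : K) = ((e * c : ℚ) : WithTop ℚ) := hve
    rw [hp] at this
    exact (WithTop.coe_injective this).symm
  have hq : w (∏ s, algebraMap K E (a s)) = (((∑ s, k s : ℕ) * c : ℚ) : WithTop ℚ) := by
    rw [← map_prod, hwv, SymmetricOrder.map_finsetProd, Nat.cast_sum, Finset.sum_mul, WithTop.coe_sum]
    exact Finset.sum_congr rfl fun s _ => hvk s
  have key := hsplit.two_mul_le hw _ _ (Algebra.TensorProduct.basis E g)
    (Algebra.TensorProduct.basis E b) (toSubmodule_generatedSubalgebra w hwv g Γ hg)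
    (toSubmodule_generatedSubalgebra w hwv b Λ hb) (fun s => algebraMap K E (a s))
    (fun s => by
      rw [Algebra.TensorProduct.basis_apply, Algebra.TensorProduct.basis_apply, hab,
        TensorProduct.tmul_smul (algebraMap (ringOfIntegers v) K (a s)), ← algebraMap_smul E]
      rfl) hq
  rw [Fintype.card_fin] at key
  have := mul_le_mul_of_nonneg_left key (Nat.cast_nonneg (α := ℚ) e)
  calc ((∑ s, k s : ℕ) : ℚ) = 1 / 2 * (e * (2 * ((∑ s, k s : ℕ) * c))) := by
        linear_combination -((∑ s, k s : ℕ) : ℚ) * hec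
    _ ≤ 1 / 2 * (e * (d * Module.finrank K A)) := by linarith
    _ = _ := by ring
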